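/- Let $\Sigma$ be a finite alphabet. A (real-time) $k$-counter machine over $\Sigma$ consists of a finite set of states $Q$, an initial state $q_0 \in Q$, a counter update function $u : \Sigma \times Q \times \{0,1\}^k \to (\{+m : m \in \mathbb{Z}\} \cup \{\times 0\})^k$, a state transition function $\delta : \Sigma \times Q \times \{0,1\}^k \to Q$ and an acceptance mask $F \subseteq Q \times \{0,1\}^k$; here $+m$ denotes the map $x \mapsto x + m$ and $\times 0$ the map $x \mapsto 0$ on $\mathbb{Z}$. For $\mathbf{c} \in \mathbb{Z}^k$ let $z(\mathbf{c}) \in \{0,1\}^k$ be given by $z(\mathbf{c})_i = 0$ if $c_i = 0$ and $z(\mathbf{c})_i = 1$ otherwise. Reading a token $\sigma$ in the configuration $\langle q, \mathbf{c} \rangle \in Q \times \mathbb{Z}^k$ leads to the configuration $\langle \delta(\sigma, q, z(\mathbf{c})), u(\sigma, q, z(\mathbf{c}))(\mathbf{c}) \rangle$, the update being applied coordinatewise. A word $x \in \Sigma^*$ is accepted if the configuration $\langle q, \mathbf{c} \rangle$ reached from $\langle q_0, \mathbf{0} \rangle$ by reading $x$ satisfies $(q, z(\mathbf{c})) \in F$;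 the machine accepts the language of all words that it accepts. The machine is simplified if $u$ depends only on the input token and takes values in $\{-1, +0, +1, \times 0\}^k$, and stateless if $Q = \{q_0\}$. Let $\tilde{\mathrm{Q}}\mathrm{SCL}$ be the class of languages accepted by a counter machine that is both simplified and stateless (with any finite number $k$ of counters). Then every $L \in \tilde{\mathrm{Q}}\mathrm{SCL}$ over the alphabet $\Sigma$ is semilinear: its Parikh image $\{\Psi(x) : x \in L\} \subseteq \mathbb{N}^{\Sigma}$, where $\Psi(x)_\sigma$ is the number of occurrences of $\sigma$ in $x$, is a finite union of linear sets, that is, of sets of the form $\{ W\mathbf{n} + \mathbf{b} : \mathbf{n} \in \mathbb{N}^m \}$ with $m \in \mathbb{N}$, $W \in \mathbb{N}^{\Sigma \times m}$ and $\mathbf{b} \in \mathbb{N}^{\Sigma}$. -/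

import Mathlib

universe u v

/-- The allowed operations on a single integer counter: `add m` is the function `x ↦ x + m`
and `reset` is the constant zero function (written `×0`). -/
inductive CounterUpdate : Type where
  | add (m : ℤ)
  | reset

/-- The function `ℤ → ℤ` denoted by a counter operation. -/
def CounterUpdate.apply : CounterUpdate → ℤ → ℤ
  | .add m, x => x + m
  | .reset, _ => 0

/-- The broadcasted zero-check `z`: the `i`-th bit is `false` (i.e. `0`) if `v i = 0`, and `true`
(i.e. `1`) otherwise. -/
def zeroCheck {k : ℕ} (v : Fin k → ℤ) : Fin k → Bool :=
  fun i => decide (v i ≠ 0)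

/-- A (general, real-time) `k`-counter machine with alphabet `α` and set of states `Q`.
Finiteness of `α` and `Q` is required where languages are considered. -/
structure CounterMachine (α : Type*) (Q : Type*) (k : ℕ) where
  /-- initial state -/
  start : Q
  /-- counter update function -/
  update : α → Q → (Fin k → Bool) → (Fin k → CounterUpdate)
  /-- state transition function -/
  trans : α → Q → (Fin k → Bool) → Q
  /-- acceptance mask -/
  accept : Set (Q × (Fin k → Bool))

namespace CounterMachine

/-- One computation step: both the new state and the new counter values are computed from the
input token, the old state and the zero-check of the old counter values. -/
def step {α Q : Type*} {k : ℕ} (M : CounterMachine α Q k)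
    (c : Q × (Fin k → ℤ)) (a : α) : Q × (Fin k → ℤ) :=
  (M.trans a c.1 (zeroCheck c.2),
    fun i => (M.update a c.1 (zeroCheck c.2) i).apply (c.2 i))

/-- The configuration reached after reading the word `w` from left to right, starting in the
initial state with all counters equal to `0`. -/
def run {α Q : Type*} {k : ℕ} (M : CounterMachine α Q k) (w : List α) : Q × (Fin k → ℤ) :=
  w.foldl M.step (M.start, 0)

/-- Real-time acceptance of a word: the final state together with the zero-check of the final
counter values lies in the acceptance mask. -/
def Accepts {α Q : Type*} {k : ℕ} (M : CounterMachine α Q k) (w : List α) : Prop :=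
  ((M.run w).1, zeroCheck (M.run w).2) ∈ M.accept

/-- Real-time acceptance of a language. -/
def AcceptsLanguage {α Q : Type*} {k : ℕ} (M : CounterMachine α Q k) (L : Language α) : Prop :=
  ∀ w : List α, M.Accepts w ↔ w ∈ L

/-- A machine is simplified if its update function depends on the input token only and takes
values in `{-1, +0, +1, ×0}` for each counter. -/
def IsSimplified {α Q : Type*} {k : ℕ} (M : CounterMachine α Q k) : Prop :=
  ∃ v : α → (Fin k → CounterUpdate),
    (∀ a q b, M.update a q b = v a) ∧
    ∀ a i, v a i = .add (-1) ∨ v a i = .add 0 ∨ v a i = .add 1 ∨ v a i = .reset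

/-- A machine is stateless if the initial state is its only state. -/
def IsStateless {α Q : Type*} {k : ℕ} (M : CounterMachine α Q k) : Prop :=
  ∀ q : Q, q = M.start

end CounterMachine

/-- The class of languages over `α` that are accepted in real time by a counter machine (with
some finite number of counters and a finite set of states) that is both simplified and
stateless. -/
def QSCL (α : Type u) : Set (Language α) :=
  {L | ∃ (k : ℕ) (Q : Type v) (_ : Finite Q) (M : CounterMachine α Q k),
    M.IsSimplified ∧ M.IsStateless ∧ M.AcceptsLanguage L}

/-- The Parikh mapping: the vector of the numbers of occurrences of each token in a word. -/
def parikh {α : Type*} [DecidableEq α] (w : List α) : α → ℕ :=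
  fun a => w.count a

/-- A language is semilinear if its image under the Parikh mapping is a semilinear set of
vectors, i.e. a finite union of sets `b + ℕ p₁ + ⋯ + ℕ pₘ`. -/
def Language.IsSemilinear {α : Type*} [DecidableEq α] (L : Language α) : Prop :=
  IsSemilinearSet (parikh '' {w : List α | w ∈ L})

open scoped Pointwise

/-! When updates depend on the token only, the final value of a counter is the sum of the increments
after its last reset. Read backwards, a word therefore needs only the set `R` of counters already
seen to be reset. This set never shrinks, so the only cycles are self-loops, and the pairs (Parikh
vector, counter values) form a semilinear set (`isSemilinearSet_range_totalWeight`). Intersecting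
with the acceptance condition and projecting finishes the proof. -/

/-- The total weight of a word read by an automaton whose states are finite sets, where the token
`a` adds the set `r a` to the state `R` and has weight `wt R a` in a commutative monoid. -/
def totalWeight {α ι N : Type*} [DecidableEq ι] [AddCommMonoid N] (wt : Finset ι → α → N)
    (r : α → Finset ι) : Finset ι → List α → N
  | _, [] => 0
  | R, a :: l => wt R a + totalWeight wt r (R ∪ r a) l

section TotalWeight

variable {α ι N : Type*} [DecidableEq ι] [AddCommMonoid N] (wt : Finset ι → α → N)
  (r : α → Finset ι)

theorem add_mem_range_totalWeight {R : Finset ι} {x y : N}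
    (hx : x ∈ AddSubmonoid.closure (wt R '' {a | r a ⊆ R}))
    (hy : y ∈ Set.range (totalWeight wt r R)) : x + y ∈ Set.range (totalWeight wt r R) := by
  induction hx using AddSubmonoid.closure_induction generalizing y with
  | mem x hx =>
    obtain ⟨a, ha, rfl⟩ := hx
    obtain ⟨l, rfl⟩ := hy
    exact ⟨a :: l, by rw [totalWeight, Finset.union_eq_left.2 ha]⟩
  | zero => simpa using hy
  | add x z _ _ ihx ihz => rw [add_assoc]; exact ihx (ihz hy)

/-- Cut the word at the first token that enlarges `R`: the tokens before it are self-loops, in any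
number and order. -/
theorem range_totalWeight_eq (R : Finset ι) :
    Set.range (totalWeight wt r R) =
      (AddSubmonoid.closure (wt R '' {a | r a ⊆ R}) : Set N) +
        ({0} ∪ ⋃ a ∈ {a | ¬ r a ⊆ R}, wt R a +ᵥ Set.range (totalWeight wt r (R ∪ r a))) := by
  apply Set.Subset.antisymm
  · rintro _ ⟨l, rfl⟩
    induction l with
    | nil => exact ⟨0, zero_mem _, 0, Or.inl rfl, add_zero 0⟩
    | cons a l ih =>
      by_cases ha : r a ⊆ R
      · obtain ⟨x, hx, y, hy, hxy⟩ := ih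
        refine ⟨wt R a + x, add_mem (AddSubmonoid.subset_closure ⟨a, ha, rfl⟩) hx, y, hy, ?_⟩
        rw [totalWeight, Finset.union_eq_left.2 ha, ← hxy]
        exact add_assoc _ _ _
      · refine ⟨0, zero_mem _, totalWeight wt r R (a :: l), Or.inr ?_, zero_add _⟩
        exact Set.mem_biUnion ha ⟨_, ⟨l, rfl⟩, rfl⟩
  · rintro _ ⟨x, hx, y, hy, rfl⟩
    refine add_mem_range_totalWeight wt r hx ?_
    rcases hy with rfl | hy
    · exact ⟨[], rfl⟩
    · obtain ⟨a, -, _, ⟨l, rfl⟩, rfl⟩ := Set.mem_iUnion₂.1 hy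
      exact ⟨a :: l, rfl⟩

theorem isSemilinearSet_range_totalWeight [Finite α] [Fintype ι] (R : Finset ι) :
    IsSemilinearSet (Set.range (totalWeight wt r R)) := by
  induction hn : Rᶜ.card using Nat.strong_induction_on generalizing R with
  | _ n ih =>
    rw [range_totalWeight_eq]
    refine (IsSemilinearSet.closure_of_finite ((Set.toFinite _).image _)).add
      ((IsSemilinearSet.singleton 0).union
        (IsSemilinearSet.biUnion (Set.toFinite _) fun a ha => (ih _ ?_ _ rfl).vadd _))
    -- A token that is not a self-loop strictly shrinks the complement of `R`.
    rw [← hn]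
    refine Finset.card_lt_card (compl_lt_compl_iff_lt.2 ?_)
    exact Finset.ssubset_iff_subset_ne.2
      ⟨Finset.subset_union_left, fun h => ha (Finset.union_eq_left.1 h.symm)⟩

end TotalWeight

/-- The amount that a counter operation adds to its counter; a reset adds nothing. -/
def CounterUpdate.increment : CounterUpdate → ℤ
  | .add m => m
  | .reset => 0

open Classical in
/-- The set of counters that a token resets. -/
noncomputable def resetSet {α : Type*} {k : ℕ} (v : α → Fin k → CounterUpdate) (a : α) :
    Finset (Fin k) :=
  Finset.univ.filter fun i => v a i = .reset

/-- The contribution of a token to the Parikh vector and to the final counter values, if the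
counters in `R` are reset later. -/
def tokenWeight {α : Type*} [DecidableEq α] {k : ℕ} (v : α → Fin k → CounterUpdate)
    (R : Finset (Fin k)) (a : α) : (α → ℕ) × (Fin k → ℤ) :=
  (Pi.single a 1, fun i => if i ∈ R then 0 else (v a i).increment)

/-- The counter values after reading a word, if updates depend on tokens only. -/
def counterValues {α : Type*} {k : ℕ} (v : α → Fin k → CounterUpdate) (w : List α) : Fin k → ℤ :=
  w.foldl (fun c a i => (v a i).apply (c i)) 0

/-- The head of `l` is the last token of `l.reverse`. If it resets `i`, then `i` joins the set and
all earlier tokens contribute `0` there. -/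
theorem totalWeight_tokenWeight {α : Type*} [DecidableEq α] {k : ℕ}
    (v : α → Fin k → CounterUpdate) (R : Finset (Fin k)) (l : List α) :
    totalWeight (tokenWeight v) (resetSet v) R l =
      (parikh l.reverse, fun i => if i ∈ R then 0 else counterValues v l.reverse i) := by
  induction l generalizing R with
  | nil => ext <;> simp [totalWeight, parikh, counterValues]
  | cons a l ih =>
    rw [totalWeight, ih]
    ext i
    · simp only [tokenWeight, parikh, Prod.fst_add, Pi.add_apply, List.count_reverse,
        List.count_cons, Pi.single_apply, beq_iff_eq, eq_comm (a := i), add_comm]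
    · by_cases hR : i ∈ R
      · simp [tokenWeight, hR]
      · cases h : v a i <;>
          simp [tokenWeight, hR, resetSet, h, counterValues, CounterUpdate.apply,
            CounterUpdate.increment, List.foldl_append, add_comm]

theorem isSemilinearSet_parikh_counterValues {α : Type*} [Finite α] [DecidableEq α] {k : ℕ}
    (v : α → Fin k → CounterUpdate) :
    IsSemilinearSet (Set.range fun w : List α => (parikh w, counterValues v w)) := by
  convert isSemilinearSet_range_totalWeight (tokenWeight v) (resetSet v) ∅ using 1
  rw [← List.reverse_surjective.range_comp]
  congr 1
  funext l
  simp [totalWeight_tokenWeight]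

theorem isSemilinearSet_setOf_zeroCheck_mem {k : ℕ} (B : Set (Fin k → Bool)) :
    IsSemilinearSet {c : Fin k → ℤ | zeroCheck c ∈ B} := by
  have hzero (i : Fin k) : IsSemilinearSet {c : Fin k → ℤ | c i = 0} :=
    (IsSemilinearSet.singleton (0 : ℤ)).preimage (Pi.evalAddMonoidHom (fun _ : Fin k => ℤ) i)
  have hset : {c : Fin k → ℤ | zeroCheck c ∈ B} =
      ⋃ b ∈ B, ⋂ i, {c : Fin k → ℤ | zeroCheck c i = b i} := by
    ext c
    simp [← funext_iff]
  rw [hset]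
  refine IsSemilinearSet.biUnion (Set.toFinite _) fun b _ => IsSemilinearSet.iInter fun i => ?_
  cases h : b i
  · simpa [zeroCheck] using hzero i
  · simpa [zeroCheck, Set.compl_ofPred] using (hzero i).compl

theorem CounterMachine.run_eq_counterValues {α Q : Type*} {k : ℕ} (M : CounterMachine α Q k)
    {v : α → Fin k → CounterUpdate} (hv : ∀ a q b, M.update a q b = v a) (hQ : M.IsStateless)
    (w : List α) : M.run w = (M.start, counterValues v w) := by
  refine Prod.ext (hQ _) ?_
  unfold CounterMachine.run counterValues
  -- The induction on a left fold needs an arbitrary starting configuration.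
  generalize hc : (0 : Fin k → ℤ) = c
  generalize M.start = q
  clear hc
  induction w generalizing q c with
  | nil => rfl
  | cons a w ih =>
    simp only [List.foldl_cons]
    rw [CounterMachine.step, ih]
    simp only [hv]

theorem theorem6 {α : Type u} [Finite α] [DecidableEq α] (L : Language α)
    (hL : L ∈ QSCL.{u, v} α) : L.IsSemilinear := by
  obtain ⟨k, Q, -, M, ⟨v, hv, -⟩, hQ, hL⟩ := hL
  -- With a single state, acceptance depends on the word only through its counter values.
  have hset : parikh '' {w : List α | w ∈ L} =
      AddMonoidHom.fst (α → ℕ) (Fin k → ℤ) ''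
        ((Set.range fun w : List α => (parikh w, counterValues v w)) ∩
          AddMonoidHom.snd (α → ℕ) (Fin k → ℤ) ⁻¹'
            {c | zeroCheck c ∈ {b | (M.start, b) ∈ M.accept}}) := by
    ext x
    simp only [← hL _, CounterMachine.Accepts, M.run_eq_counterValues hv hQ]
    constructor
    · rintro ⟨w, hw, rfl⟩
      exact ⟨_, ⟨⟨w, rfl⟩, hw⟩, rfl⟩
    · rintro ⟨_, ⟨⟨w, rfl⟩, hw⟩, rfl⟩
      exact ⟨w, hw, rfl⟩
  rw [Language.IsSemilinear, hset]
  exact ((isSemilinearSet_parikh_counterValues v).inter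
    ((isSemilinearSet_setOf_zeroCheck_mem _).preimage _)).image _
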